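/- Let $E$ be a real locally convex space and let $\mathcal A\subseteq E$ be a bounded, convex, complete, separable, metrizable subset. Here "complete, separable, metrizable" means that there are countably many continuous seminorms on $E$ such that the pseudometric they generate is a metric on $\mathcal A$, this metric induces on $\mathcal A$ the topology inherited from $E$, and $\mathcal A$ is separable and complete in this metric. Let $M(\mathcal A)$ be the set of Borel probability measures on $\mathcal A$ with the topology of weak convergence. The barycenter $\mathbf b(\mu)\in\mathcal A$ of $\mu\in M(\mathcal A)$ is the Pettis integral $\int_{\mathcal A}x\,\mu(dx)$, i.e. the point with $\varphi(\mathbf b(\mu))=\int_{\mathcal A}\varphi\,d\mu$ for every continuous linear functional $\varphi$ on $E$. The set $\mathcal A$ is called $\mu$-compact if for every compact $K\subseteq\mathcal A$ the preimage $\mathbf b^{-1}(K)$ is a compact subset of $M(\mathcal A)$. For a function $f:\mathcal A\to[-\infty,+\infty]$ its convex closure $\overline{\mathrm{co}}f$ is the greatest convex lower semicontinuous function $\mathcal A\to[-\infty,+\infty]$ majorized by $f$. Let $C(\mathcal A)$ be the set of all continuous bounded functions $\mathcal A\to\mathbb R$. Increasing and decreasing sequences are understood in the non-strict, pointwise sense.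 **Theorem.** The following properties are equivalent: (i) the set $\mathcal A$ is $\mu$-compact; (ii) for every increasing sequence $\{f_n\}\subset C(\mathcal A)$ converging pointwise to a function $f_0\in C(\mathcal A)$, the sequence $\{\overline{\mathrm{co}}f_n\}$ converges pointwise to $\overline{\mathrm{co}}f_0$; (iii) for every increasing sequence $\{f_n\}$ of lower semicontinuous functions $\mathcal A\to(-\infty,+\infty]$, each bounded below by a real constant, converging pointwise to a function $f_0:\mathcal A\to(-\infty,+\infty]$, the sequence $\{\overline{\mathrm{co}}f_n\}$ converges pointwise to $\overline{\mathrm{co}}f_0$ (limits are taken in $[-\infty,+\infty]$). If these equivalent properties hold, then for every decreasing sequence $\{f_n\}$ of lower semicontinuous bounded functions $\mathcal A\to\mathbb R$ converging pointwise to a lower semicontinuous bounded function $f_0:\mathcal A\to\mathbb R$, the sequence $\{\overline{\mathrm{co}}f_n\}$ converges pointwise to $\overline{\mathrm{co}}f_0$. -/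

import Mathlib

open Filter Topology MeasureTheory
open scoped BoundedContinuousFunction

namespace MuCompact

variable {E : Type*} [AddCommGroup E] [Module ℝ E]

/-- The (bounded) translation-invariant pseudometric generated by a sequence of seminorms:
`d(x, y) = ∑ₙ 2⁻⁽ⁿ⁺¹⁾ min(1, pₙ(x - y))`. The series always converges. -/
noncomputable def seminormDist (p : ℕ → Seminorm ℝ E) (x y : E) : ℝ :=
  ∑' n : ℕ, (1 / 2 : ℝ) ^ (n + 1) * min 1 (p n (x - y))

/-- `A` is a complete metrizable subset of the topological vector space `E`: there are countably
many continuous seminorms on `E` such that the pseudometric that they generate is a metric on `A`,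
induces the subspace topology of `A`, and makes `A` complete. -/
def IsCompleteMetrizable [TopologicalSpace E] (A : Set E) : Prop :=
  ∃ p : ℕ → Seminorm ℝ E, (∀ n, Continuous (p n)) ∧
    ∃ m : MetricSpace A,
      (∀ x y : A, m.dist x y = seminormDist p (x : E) (y : E)) ∧
      m.toUniformSpace.toTopologicalSpace = (inferInstance : TopologicalSpace A) ∧
      @CompleteSpace A m.toUniformSpace

/-- `x` is the barycenter of the probability measure `μ` on `A`, that is, `x` is the Pettis
integral `∫ a, a ∂μ`. -/
def IsBarycenter [TopologicalSpace E] {A : Set E} [MeasurableSpace A]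
    (μ : ProbabilityMeasure A) (x : A) : Prop :=
  ∀ φ : E →L[ℝ] ℝ, Integrable (fun a : A => φ a) (μ : Measure A) ∧
    ∫ a : A, φ a ∂(μ : Measure A) = φ x

/-- `A` is `μ`-compact: the preimage of every compact subset of `A` under the barycenter map is
compact in the space of Borel probability measures on `A` with the weak convergence topology. -/
def IsMuCompact [TopologicalSpace E] (A : Set E) [MeasurableSpace A] [BorelSpace A] : Prop :=
  ∀ K : Set A, IsCompact K →
    IsCompact {μ : ProbabilityMeasure A | ∃ x ∈ K, IsBarycenter μ x}

/-- An extended real valued function on `A` is convex if its epigraph is a convex set. -/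
def IsConvexFun {A : Set E} (g : A → EReal) : Prop :=
  Convex ℝ {q : E × ℝ | ∃ h : q.1 ∈ A, g ⟨q.1, h⟩ ≤ (q.2 : EReal)}

/-- The convex lower semicontinuous functions on `A` that are majorized by `f`. -/
def closedConvexMinorants [TopologicalSpace E] {A : Set E} (f : A → EReal) : Set (A → EReal) :=
  {g | IsConvexFun g ∧ LowerSemicontinuous g ∧ g ≤ f}

/-- The convex closure of `f`: the greatest convex lower semicontinuous function majorized by `f`
(see `isGreatest_convexClosure`). -/
noncomputable def convexClosure [TopologicalSpace E] {A : Set E} (f : A → EReal) : A → EReal :=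
  sSup (closedConvexMinorants f)

theorem isGreatest_convexClosure [TopologicalSpace E] {A : Set E} (hA : Convex ℝ A)
    (f : A → EReal) : IsGreatest (closedConvexMinorants f) (convexClosure f) := by
  refine ⟨⟨?_, ?_, ?_⟩, fun g hg => le_sSup hg⟩
  · rintro ⟨x, r⟩ ⟨hx, hxr⟩ ⟨y, s⟩ ⟨hy, hys⟩ a b ha hb hab
    refine ⟨hA hx hy ha hb hab, ?_⟩
    rw [convexClosure, sSup_apply]
    refine iSup_le fun g => ?_
    have h1 : (g : A → EReal) ⟨x, hx⟩ ≤ (r : EReal) :=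
      le_trans ((le_sSup g.2 : (g : A → EReal) ≤ convexClosure f) _) hxr
    have h2 : (g : A → EReal) ⟨y, hy⟩ ≤ (s : EReal) :=
      le_trans ((le_sSup g.2 : (g : A → EReal) ≤ convexClosure f) _) hys
    obtain ⟨_, h⟩ := g.2.1 (x := (x, r)) ⟨hx, h1⟩ (y := (y, s)) ⟨hy, h2⟩ ha hb hab
    exact h
  · have : convexClosure f = fun x => ⨆ g : closedConvexMinorants f, (g : A → EReal) x := by
      funext x
      rw [convexClosure, sSup_apply]
    rw [this]
    exact lowerSemicontinuous_iSup fun g => g.2.2.1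
  · exact sSup_le fun g hg => hg.2.2

end MuCompact

open scoped ENNReal

/-!
Write a function bounded below as `c + F` with `F ≥ 0`. The link between the convex closure and
barycenters is the inequality `convexClosure (c + F) x ≤ c + ∫ F dμ` for every measure `μ` with
barycenter `x` (`convexClosure_le_lintegral`). It holds because a convex lower semicontinuous
function that is bounded below is a supremum of continuous affine functions
(`IsConvexFun.exists_affine_minorant`, by Hahn–Banach), and these commute with barycenters.

On a `μ`-compact set this becomes an equality with the minimum over `μ` when `F` is lower
semicontinuous (`IsMuCompact.convexClosure_eq`). Indeed the minimum is attained, and it is a convex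
lower semicontinuous function of `x`, majorized by `F` since point masses are admissible.
Attainment, lower semicontinuity and the continuity along increasing sequences all come from one
compactness statement, `IsMuCompact.exists_lintegral_le`: measures with convergent barycenters
subconverge, and integrals of lower semicontinuous functions can only drop in the limit. For a
decreasing sequence, the optimal measure of the limit function is a competitor for every term, and
the integrals against it converge.

Conversely, suppose that the convex closure is continuous along increasing sequences of bounded
continuous functions. Take a dense sequence in `A` and let `fₙ` be a continuous function that is `1`
on its first `n` balls of radius `δ` and `0` off the balls of radius `2δ`. Then `fₙ` increases to
`1`, so the convex closures of `fₙ` increase to `1`, uniformly on a compact set `K` by Dini's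
argument. By Jensen's inequality the first `n` balls carry almost all the mass of every measure with
barycenter in `K`, for a suitable `n`. So these measures form a tight family, which is relatively
compact by Prokhorov's theorem, and it is closed because barycenters pass to weak limits
(`isMuCompact_of_tendsto_convexClosure`). The existence of barycenters is nowhere needed.
-/

/-! ### Integrals of lower semicontinuous functions and tightness -/

namespace MeasureTheory

variable {Ω : Type*} [MeasurableSpace Ω] [TopologicalSpace Ω]

/-- The integral of a nonnegative lower semicontinuous function is sequentially lower
semicontinuous under weak convergence of the measures. -/
theorem lintegral_le_liminf_of_lowerSemicontinuous [OpensMeasurableSpace Ω]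
    [HasOuterApproxClosed Ω] {μ : ProbabilityMeasure Ω} {μs : ℕ → ProbabilityMeasure Ω}
    (hμ : Tendsto μs atTop (𝓝 μ)) {F : Ω → ℝ≥0∞} (hF : LowerSemicontinuous F) :
    ∫⁻ x, F x ∂(μ : Measure Ω) ≤ atTop.liminf fun i => ∫⁻ x, F x ∂(μs i : Measure Ω) := by
  have hFm : Measurable F := hF.measurable
  -- The layer cake formula is available for finite functions only, so `F` is truncated.
  have htrunc : ∀ n : ℕ, ∫⁻ x, min (F x) n ∂(μ : Measure Ω) ≤
      atTop.liminf fun i => ∫⁻ x, F x ∂(μs i : Measure Ω) := by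
    intro n
    have hfin : ∀ x, min (F x) (n : ℝ≥0∞) ≠ ∞ := fun x =>
      ne_top_of_le_ne_top (ENNReal.natCast_ne_top n) (min_le_right _ _)
    have hlayer : ∀ ν : Measure Ω, ∫⁻ x, min (F x) n ∂ν =
        ∫⁻ t in Set.Ioi (0 : ℝ), ν {x | t < (min (F x) n).toReal} := fun ν => by
      rw [← lintegral_eq_lintegral_meas_lt ν
        (Eventually.of_forall fun x => ENNReal.toReal_nonneg)
        (hFm.min measurable_const).ennreal_toReal.aemeasurable]
      exact lintegral_congr fun x => (ENNReal.ofReal_toReal (hfin x)).symm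
    have hopen : ∀ t : ℝ, t ∈ Set.Ioi (0 : ℝ) →
        IsOpen {x | t < (min (F x) (n : ℝ≥0∞)).toReal} := fun t ht => by
      simp_rw [← ENNReal.ofReal_lt_iff_lt_toReal (le_of_lt ht) (hfin _), lt_min_iff]
      exact (hF.isOpen_preimage _).inter isOpen_const
    calc ∫⁻ x, min (F x) n ∂(μ : Measure Ω)
        = ∫⁻ t in Set.Ioi (0 : ℝ), (μ : Measure Ω) {x | t < (min (F x) n).toReal} := hlayer _
      _ ≤ ∫⁻ t in Set.Ioi (0 : ℝ), atTop.liminf fun i =>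
            (μs i : Measure Ω) {x | t < (min (F x) n).toReal} :=
          setLIntegral_mono' measurableSet_Ioi fun t ht =>
            ProbabilityMeasure.le_liminf_measure_open_of_tendsto hμ (hopen t ht)
      _ ≤ atTop.liminf fun i => ∫⁻ t in Set.Ioi (0 : ℝ),
            (μs i : Measure Ω) {x | t < (min (F x) n).toReal} :=
          lintegral_liminf_le fun i => Antitone.measurable fun s t hst =>
            measure_mono fun x hx => lt_of_le_of_lt hst hx
      _ ≤ atTop.liminf fun i => ∫⁻ x, F x ∂(μs i : Measure Ω) := by
          refine liminf_le_liminf (Eventually.of_forall fun i => ?_)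
          rw [← hlayer]
          exact lintegral_mono fun x => min_le_left _ _
  have hsup : ∀ x, F x = ⨆ n : ℕ, min (F x) n := fun x => by
    rw [← inf_iSup_eq, ENNReal.iSup_natCast, inf_top_eq]
  calc ∫⁻ x, F x ∂(μ : Measure Ω) = ∫⁻ x, ⨆ n : ℕ, min (F x) n ∂(μ : Measure Ω) :=
        lintegral_congr hsup
    _ = ⨆ n : ℕ, ∫⁻ x, min (F x) n ∂(μ : Measure Ω) :=
        lintegral_iSup (fun n => hFm.min measurable_const) fun m n hmn x =>
          min_le_min_left _ (by exact_mod_cast hmn)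
    _ ≤ _ := iSup_le htrunc

/-- A family of measures on a complete metric space is tight as soon as, at every scale `δ`,
finitely many closed balls of radius `δ` carry almost all the mass uniformly over the family. -/
theorem isTightMeasureSet_of_forall_exists_closedBall {X : Type*} [MetricSpace X]
    [CompleteSpace X] [MeasurableSpace X] {S : Set (Measure X)} {D : ℕ → X}
    (h : ∀ δ : ℝ, 0 < δ → ∀ ε : ℝ≥0∞, 0 < ε → ∃ n : ℕ, ∀ μ ∈ S,
      μ (⋃ i ∈ Finset.range n, Metric.closedBall (D i) δ)ᶜ ≤ ε) :
    IsTightMeasureSet S := by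
  rw [isTightMeasureSet_iff_exists_isCompact_measure_compl_le]
  intro ε hε
  obtain ⟨ε', hε'0, hε'⟩ := ENNReal.exists_pos_sum_of_countable' hε.ne' ℕ
  have hδ : ∀ m : ℕ, (0 : ℝ) < 1 / (m + 1) := fun m => Nat.one_div_pos_of_nat
  choose n hn using fun m : ℕ => h _ (hδ m) _ (hε'0 m)
  refine ⟨⋂ m : ℕ, ⋃ i ∈ Finset.range (n m), Metric.closedBall (D i) (1 / (m + 1)), ?_,
    fun μ hμ => ?_⟩
  · refine TotallyBounded.isCompact_of_isClosed ?_ (isClosed_iInter fun m =>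
      isClosed_biUnion_finset fun i _ => Metric.isClosed_closedBall)
    refine Metric.totallyBounded_iff.2 fun r hr => ?_
    obtain ⟨m, hm⟩ := exists_nat_one_div_lt hr
    refine ⟨D '' Finset.range (n m), (Finset.finite_toSet _).image D, ?_⟩
    refine (Set.iInter_subset _ m).trans (Set.iUnion₂_subset fun i hi x hx => ?_)
    exact Set.mem_biUnion (Set.mem_image_of_mem D hi)
      (lt_of_le_of_lt (Metric.mem_closedBall.1 hx) hm)
  · rw [Set.compl_iInter]
    calc _ ≤ ∑' m : ℕ, μ (⋃ i ∈ Finset.range (n m), Metric.closedBall (D i) (1 / (m + 1)))ᶜ :=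
          measure_iUnion_le _
      _ ≤ ∑' m, ε' m := ENNReal.tsum_le_tsum fun m => hn m μ hμ
      _ ≤ ε := hε'.le

end MeasureTheory

namespace MuCompact

/-! ### Mixtures of probability measures -/

section Mix

variable {Ω : Type*} [MeasurableSpace Ω]

/-- The mixture `a μ + b ν` of two probability measures. -/
noncomputable def mix (μ ν : ProbabilityMeasure Ω) {a b : ℝ} (ha : 0 ≤ a) (hb : 0 ≤ b)
    (hab : a + b = 1) : ProbabilityMeasure Ω :=
  ⟨ENNReal.ofReal a • (μ : Measure Ω) + ENNReal.ofReal b • (ν : Measure Ω), ⟨by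
    simp [← ENNReal.ofReal_add ha hb, hab]⟩⟩

theorem lintegral_mix (μ ν : ProbabilityMeasure Ω) {a b : ℝ} (ha : 0 ≤ a) (hb : 0 ≤ b)
    (hab : a + b = 1) (F : Ω → ℝ≥0∞) :
    ∫⁻ z, F z ∂(mix μ ν ha hb hab : Measure Ω) =
      ENNReal.ofReal a * ∫⁻ z, F z ∂(μ : Measure Ω) +
        ENNReal.ofReal b * ∫⁻ z, F z ∂(ν : Measure Ω) := by
  simp [mix, lintegral_add_measure, lintegral_smul_measure]

end Mix

/-! ### Barycenters -/

section Barycenters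

variable {E : Type*} [AddCommGroup E] [Module ℝ E] [TopologicalSpace E] {A : Set E}

theorem IsCompleteMetrizable.isCompletelyMetrizableSpace (h : IsCompleteMetrizable A) :
    TopologicalSpace.IsCompletelyMetrizableSpace A := by
  obtain ⟨p, -, m, -, htop, hcomplete⟩ := h
  exact ⟨⟨m, htop, hcomplete⟩⟩

theorem exists_norm_apply_le_of_isVonNBounded (hA : Bornology.IsVonNBounded ℝ A)
    (φ : E →L[ℝ] ℝ) : ∃ C : ℝ, ∀ a : A, ‖φ a‖ ≤ C := by
  obtain ⟨C, hC⟩ := isBounded_iff_forall_norm_le.1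
    ((NormedSpace.isVonNBounded_iff ℝ).1 (hA.image φ))
  exact ⟨C, fun a => hC _ (Set.mem_image_of_mem φ a.2)⟩

/-- The restriction to `A` of a continuous linear functional, as a bounded continuous function. -/
noncomputable def boundedRestrict (hA : Bornology.IsVonNBounded ℝ A) (φ : E →L[ℝ] ℝ) : A →ᵇ ℝ :=
  BoundedContinuousFunction.ofNormedAddCommGroup (fun a : A => φ a)
    (φ.continuous.comp continuous_subtype_val) _
    (exists_norm_apply_le_of_isVonNBounded hA φ).choose_spec

variable [MeasurableSpace A]

/-- The set of pairs (measure, barycenter) is closed under weak convergence of the measures. -/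
theorem IsBarycenter.of_tendsto [BorelSpace A] (hA : Bornology.IsVonNBounded ℝ A)
    {μs : ℕ → ProbabilityMeasure A} {μ : ProbabilityMeasure A} {xs : ℕ → A} {x : A}
    (hb : ∀ n, IsBarycenter (μs n) (xs n)) (hμ : Tendsto μs atTop (𝓝 μ))
    (hx : Tendsto xs atTop (𝓝 x)) : IsBarycenter μ x := by
  intro φ
  refine ⟨(boundedRestrict hA φ).integrable _, ?_⟩
  have h1 := (ProbabilityMeasure.tendsto_iff_forall_integral_tendsto.1 hμ) (boundedRestrict hA φ)
  have h2 : Tendsto (fun n => φ (xs n)) atTop (𝓝 (φ x)) :=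
    ((φ.continuous.comp continuous_subtype_val).tendsto x).comp hx
  refine tendsto_nhds_unique h1 (h2.congr fun n => ?_)
  exact (hb n φ).2.symm

theorem isBarycenter_diracProba [BorelSpace A] (x : A) : IsBarycenter (diracProba x) x := by
  intro φ
  have hm : StronglyMeasurable fun a : A => φ a :=
    (φ.continuous.comp continuous_subtype_val).stronglyMeasurable
  exact ⟨(integrable_dirac' hm (by simp)), integral_dirac' _ _ hm⟩

theorem IsBarycenter.mix {μ ν : ProbabilityMeasure A} {x y : A} (hμ : IsBarycenter μ x)
    (hν : IsBarycenter ν y) {a b : ℝ} (ha : 0 ≤ a) (hb : 0 ≤ b) (hab : a + b = 1) {z : A}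
    (hz : (z : E) = a • (x : E) + b • (y : E)) : IsBarycenter (mix μ ν ha hb hab) z := by
  intro φ
  have h1 := (hμ φ).1.smul_measure (ENNReal.ofReal_ne_top (r := a))
  have h2 := (hν φ).1.smul_measure (ENNReal.ofReal_ne_top (r := b))
  refine ⟨h1.add_measure h2, ?_⟩
  simp only [MuCompact.mix, ProbabilityMeasure.coe_mk]
  rw [integral_add_measure h1 h2, integral_smul_measure, integral_smul_measure, (hμ φ).2,
    (hν φ).2, ENNReal.toReal_ofReal ha, ENNReal.toReal_ofReal hb, hz]
  simp

end Barycenters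

/-! ### Jensen's inequality for the convex closure -/

section Jensen

variable {E : Type*} [AddCommGroup E] [Module ℝ E] {A : Set E}

theorem isConvexFun_const (hA : Convex ℝ A) (c : ℝ) : IsConvexFun fun _ : A => (c : EReal) := by
  rintro ⟨x, r⟩ ⟨hx, hr⟩ ⟨y, s⟩ ⟨hy, hs⟩ a b ha hb hab
  refine ⟨hA hx hy ha hb hab, ?_⟩
  have hr' : c ≤ r := EReal.coe_le_coe_iff.1 hr
  have hs' : c ≤ s := EReal.coe_le_coe_iff.1 hs
  exact EReal.coe_le_coe_iff.2 (convex_Ici c hr' hs' ha hb hab)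

variable [TopologicalSpace E]

theorem le_convexClosure_of_forall_le (hA : Convex ℝ A) {f : A → EReal} {c : ℝ}
    (h : ∀ a, (c : EReal) ≤ f a) (x : A) : (c : EReal) ≤ convexClosure f x :=
  (isGreatest_convexClosure hA f).2
    ⟨isConvexFun_const hA c, lowerSemicontinuous_const, h⟩ x

theorem convexClosure_mono (hA : Convex ℝ A) {f g : A → EReal} (h : f ≤ g) :
    convexClosure f ≤ convexClosure g := by
  obtain ⟨h1, h2, h3⟩ := (isGreatest_convexClosure hA f).1
  exact (isGreatest_convexClosure hA g).2 ⟨h1, h2, h3.trans h⟩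

variable [IsTopologicalAddGroup E] [ContinuousSMul ℝ E] [LocallyConvexSpace ℝ E]

/-- A convex lower semicontinuous function that is bounded below is the supremum of its continuous
affine minorants. Only points of `A` are separated from the epigraph, so `A` need not be closed. -/
theorem IsConvexFun.exists_affine_minorant {g : A → EReal} (hg : IsConvexFun g)
    (hlsc : LowerSemicontinuous g) {c : ℝ} (hc : ∀ a, (c : EReal) ≤ g a) {x : A} {r : ℝ}
    (hr : (r : EReal) < g x) :
    ∃ (φ : E →L[ℝ] ℝ) (k : ℝ), r < φ x + k ∧ ∀ a : A, ((φ a + k : ℝ) : EReal) ≤ g a := by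
  set S : Set (E × ℝ) := {q | ∃ h : q.1 ∈ A, g ⟨q.1, h⟩ ≤ (q.2 : EReal)} with hS
  obtain ⟨r', hrr', hr'⟩ := EReal.lt_iff_exists_real_btwn.1 hr
  have hnot : ((x : E), r) ∉ closure S := by
    obtain ⟨U, hU, hUeq⟩ := isOpen_induced_iff.1 (hlsc.isOpen_preimage (r' : EReal))
    have hxU : (x : E) ∈ U := by
      have : x ∈ ((↑) : A → E) ⁻¹' U := hUeq ▸ hr'
      exact this
    intro hcl
    obtain ⟨⟨y, t⟩, ⟨hyU, ht⟩, hyA, hyt⟩ := mem_closure_iff.1 hcl (U ×ˢ Set.Iio r')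
      (hU.prod isOpen_Iio) ⟨hxU, EReal.coe_lt_coe_iff.1 hrr'⟩
    have hy : (⟨y, hyA⟩ : A) ∈ g ⁻¹' Set.Ioi (r' : EReal) := hUeq ▸ hyU
    exact absurd (EReal.coe_lt_coe_iff.1 (lt_of_lt_of_le hy hyt)) (not_lt.2 (le_of_lt ht))
  obtain ⟨f, u, hfx, hfS⟩ :=
    geometric_hahn_banach_point_closed hg.closure isClosed_closure hnot
  set φ : E →L[ℝ] ℝ := f.comp (ContinuousLinearMap.inl ℝ E ℝ) with hφ
  set s : ℝ := f (0, 1) with hs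
  have hf : ∀ (y : E) (t : ℝ), f (y, t) = φ y + t * s := fun y t => by
    have : (y, t) = ContinuousLinearMap.inl ℝ E ℝ y + t • ((0, 1) : E × ℝ) := by simp
    rw [this, map_add, map_smul, smul_eq_mul]
    rfl
  rw [hf] at hfx
  have hepi : ∀ (a : A) (t : ℝ), g a ≤ (t : EReal) → u < φ a + t * s := fun a t hat => by
    rw [← hf]
    exact hfS _ (subset_closure ⟨a.2, hat⟩)
  have hbot : ∀ a, g a ≠ ⊥ := fun a h => by
    have := hc a
    rw [h, le_bot_iff] at this
    exact EReal.coe_ne_bot c this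
  by_cases hdom : ∀ a, g a = ⊤
  · exact ⟨0, r + 1, by simp, fun a => by rw [hdom a]; exact le_top⟩
  push Not at hdom
  obtain ⟨a₀, ha₀⟩ := hdom
  have hs0 : 0 ≤ s := by
    by_contra hneg
    push Not at hneg
    -- The epigraph contains an upward half-line, on which the functional is bounded below.
    set t₀ := (g a₀).toReal
    have ht₀ : g a₀ = (t₀ : EReal) := (EReal.coe_toReal ha₀ (hbot a₀)).symm
    have h := hepi a₀ (max t₀ ((u - φ a₀) / s)) (by
      rw [ht₀]; exact EReal.coe_le_coe_iff.2 (le_max_left _ _))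
    have h2 : max t₀ ((u - φ a₀) / s) * s ≤ (u - φ a₀) / s * s :=
      mul_le_mul_of_nonpos_right (le_max_right _ _) hneg.le
    rw [div_mul_cancel₀ _ hneg.ne] at h2
    linarith
  rcases hs0.eq_or_lt with hs0 | hs0
  · -- A vertical hyperplane separates `x` from the domain of `g`; a large multiple of it, added to
    -- the lower bound `c`, is a minorant.
    rw [← hs0] at hfx hepi
    have hd : 0 < u - φ x := by linarith
    set N : ℝ := (|r - c| + 1) / (u - φ x) with hN
    have hN0 : 0 < N := by positivity
    refine ⟨-(N • φ), c + N * u, ?_, fun a => ?_⟩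
    · have h1 : N * (u - φ x) = |r - c| + 1 := div_mul_cancel₀ _ hd.ne'
      have h2 := le_abs_self (r - c)
      simp only [neg_apply, smul_apply, smul_eq_mul]
      linarith
    · by_cases ha : g a = ⊤
      · rw [ha]; exact le_top
      · have h1 := hepi a (g a).toReal (EReal.coe_toReal ha (hbot a)).ge
        refine le_trans (EReal.coe_le_coe_iff.2 ?_) (hc a)
        have h2 : N * (u - φ a) ≤ 0 := mul_nonpos_of_nonneg_of_nonpos hN0.le (by linarith)
        simp only [neg_apply, smul_apply, smul_eq_mul]
        linarith
  · have hinv : s⁻¹ * s = 1 := inv_mul_cancel₀ hs0.ne'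
    refine ⟨-(s⁻¹ • φ), s⁻¹ * u, ?_, fun a => ?_⟩
    · have h1 : s⁻¹ * (φ x + r * s) < s⁻¹ * u := mul_lt_mul_of_pos_left hfx (inv_pos.2 hs0)
      have h2 : s⁻¹ * (φ x + r * s) = s⁻¹ * φ x + r := by linear_combination r * hinv
      simp only [neg_apply, smul_apply, smul_eq_mul]
      linarith
    · by_cases ha : g a = ⊤
      · rw [ha]; exact le_top
      · set t := (g a).toReal
        have ht : g a = (t : EReal) := (EReal.coe_toReal ha (hbot a)).symm
        have h1 : s⁻¹ * u < s⁻¹ * (φ a + t * s) :=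
          mul_lt_mul_of_pos_left (hepi a t ht.le) (inv_pos.2 hs0)
        have h2 : s⁻¹ * (φ a + t * s) = s⁻¹ * φ a + t := by linear_combination t * hinv
        rw [ht]
        refine EReal.coe_le_coe_iff.2 ?_
        simp only [neg_apply, smul_apply, smul_eq_mul]
        linarith

/-- **Jensen's inequality**. The convex closure of a function that is bounded below, written as
`c + F` with `F ≥ 0`, is at most the mean of the function over any measure with the given
barycenter. -/
theorem convexClosure_le_lintegral [MeasurableSpace A] (hA : Convex ℝ A) (c : ℝ) (F : A → ℝ≥0∞)
    {μ : ProbabilityMeasure A} {x : A} (hμ : IsBarycenter μ x) :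
    convexClosure (fun a => (c : EReal) + F a) x ≤
      (c : EReal) + (∫⁻ a, F a ∂(μ : Measure A) : ℝ≥0∞) := by
  by_contra hlt
  push Not at hlt
  obtain ⟨hconv, hlsc, hle⟩ :=
    (isGreatest_convexClosure hA fun a => (c : EReal) + F a).1
  obtain ⟨r, hr1, hr2⟩ := EReal.lt_iff_exists_real_btwn.1 hlt
  have hc : ∀ a, (c : EReal) ≤ convexClosure (fun a => (c : EReal) + F a) a :=
    le_convexClosure_of_forall_le hA fun a => le_add_of_nonneg_right (EReal.coe_ennreal_nonneg _)
  obtain ⟨φ, k, hφx, hφ⟩ := hconv.exists_affine_minorant hlsc hc hr2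
  set I : ℝ≥0∞ := ∫⁻ a, F a ∂(μ : Measure A) with hI
  have hItop : I ≠ ∞ := by
    rintro h
    rw [h, EReal.coe_ennreal_top, EReal.coe_add_top] at hr1
    exact not_top_lt hr1
  have hIr : c + I.toReal < r := by
    rw [← ENNReal.ofReal_toReal hItop, EReal.coe_ennreal_ofReal,
      max_eq_left ENNReal.toReal_nonneg] at hr1
    exact_mod_cast hr1
  have hpt : ∀ a : A, ENNReal.ofReal (φ a + (k - c)) ≤ F a := fun a => by
    rcases eq_or_ne (F a) ∞ with h | h
    · rw [h]; exact le_top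
    · have h1 := (hφ a).trans (hle a)
      simp only at h1
      rw [← ENNReal.ofReal_toReal h, EReal.coe_ennreal_ofReal,
        max_eq_left ENNReal.toReal_nonneg] at h1
      have h2 : φ a + k ≤ c + (F a).toReal := by exact_mod_cast h1
      exact ENNReal.ofReal_le_of_le_toReal (by linarith)
  have hint : Integrable (fun a : A => φ a + (k - c)) (μ : Measure A) :=
    (hμ φ).1.add (integrable_const _)
  have hmean : ∫ a, (φ a + (k - c)) ∂(μ : Measure A) = φ x + (k - c) := by
    rw [integral_add (hμ φ).1 (integrable_const _), (hμ φ).2]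
    simp
  have hle' : ∫ a, (φ a + (k - c)) ∂(μ : Measure A) ≤ I.toReal := by
    rw [integral_eq_lintegral_pos_part_sub_lintegral_neg_part hint]
    refine (sub_le_self _ ENNReal.toReal_nonneg).trans ?_
    exact ENNReal.toReal_mono hItop (lintegral_mono hpt)
  linarith

end Jensen

/-! ### The convex closure as a minimum over measures with a given barycenter -/

section Duality

theorem continuous_coe_add_coe_ennreal (c : ℝ) :
    Continuous fun v : ℝ≥0∞ => (c : EReal) + (v : EReal) :=
  continuous_iff_continuousAt.2 fun _ =>
    ContinuousAt.comp (f := fun v : ℝ≥0∞ => ((c : EReal), (v : EReal)))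
      (EReal.continuousAt_add (Or.inl (EReal.coe_ne_top c)) (Or.inl (EReal.coe_ne_bot c)))
      (continuous_const.prodMk continuous_coe_ennreal_ereal).continuousAt

theorem monotone_coe_add_coe_ennreal (c : ℝ) :
    Monotone fun v : ℝ≥0∞ => (c : EReal) + (v : EReal) := fun _ _ h =>
  add_le_add_right (EReal.coe_ennreal_le_coe_ennreal_iff.2 h) _

theorem coe_add_coe_ennreal_le_coe_iff (c : ℝ) (v : ℝ≥0∞) (r : ℝ) :
    (c : EReal) + (v : EReal) ≤ (r : EReal) ↔ ∃ w : ℝ, 0 ≤ w ∧ c + w ≤ r ∧ v ≤ ENNReal.ofReal w := by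
  constructor
  · intro h
    have hv : v ≠ ∞ := by
      rintro rfl
      rw [EReal.coe_ennreal_top, EReal.coe_add_top, top_le_iff] at h
      exact EReal.coe_ne_top r h
    refine ⟨v.toReal, ENNReal.toReal_nonneg, ?_, (ENNReal.ofReal_toReal hv).ge⟩
    rw [← ENNReal.ofReal_toReal hv, EReal.coe_ennreal_ofReal,
      max_eq_left ENNReal.toReal_nonneg] at h
    exact_mod_cast h
  · rintro ⟨w, hw, hcw, hv⟩
    refine (monotone_coe_add_coe_ennreal c hv).trans ?_
    simp only [EReal.coe_ennreal_ofReal, max_eq_left hw]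
    exact_mod_cast hcw

variable {E : Type*} [AddCommGroup E] [Module ℝ E] [TopologicalSpace E] {A : Set E}
  [MeasurableSpace A]

/-- The infimum of the integrals of `F` over the probability measures with barycenter `x`. -/
noncomputable def barycentricInf (F : A → ℝ≥0∞) (x : A) : ℝ≥0∞ :=
  sInf {v | ∃ μ : ProbabilityMeasure A, IsBarycenter μ x ∧ ∫⁻ a, F a ∂(μ : Measure A) = v}

theorem barycentricInf_le {F : A → ℝ≥0∞} {μ : ProbabilityMeasure A} {x : A}
    (h : IsBarycenter μ x) : barycentricInf F x ≤ ∫⁻ a, F a ∂(μ : Measure A) :=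
  sInf_le ⟨μ, h, rfl⟩

theorem barycentricInf_mono {F G : A → ℝ≥0∞} (h : F ≤ G) (x : A) :
    barycentricInf F x ≤ barycentricInf G x := by
  refine le_sInf ?_
  rintro _ ⟨μ, hμ, rfl⟩
  exact (barycentricInf_le hμ).trans (lintegral_mono h)

variable [BorelSpace A]

theorem barycentricInf_le_self {F : A → ℝ≥0∞} (hF : Measurable F) (x : A) :
    barycentricInf F x ≤ F x := by
  refine (barycentricInf_le (isBarycenter_diracProba x)).trans ?_
  simp [diracProba, lintegral_dirac' x hF]

variable [TopologicalSpace.MetrizableSpace A] [TopologicalSpace.SeparableSpace A]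

/-- The compactness principle behind the theorem: if the means of an increasing sequence of lower
semicontinuous functions over measures with convergent barycenters stay bounded, then the supremum
of the sequence has a bounded mean over some measure with the limiting barycenter. -/
theorem IsMuCompact.exists_lintegral_le (hcomp : IsMuCompact A)
    (hbdd : Bornology.IsVonNBounded ℝ A) {F : ℕ → A → ℝ≥0∞} (hmono : Monotone F)
    (hF : ∀ n, LowerSemicontinuous (F n)) {xs : ℕ → A} {x : A} (hx : Tendsto xs atTop (𝓝 x))
    {μs : ℕ → ProbabilityMeasure A} (hb : ∀ n, IsBarycenter (μs n) (xs n)) {vs : ℕ → ℝ≥0∞}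
    {v : ℝ≥0∞} (hv : Tendsto vs atTop (𝓝 v))
    (hle : ∀ n, ∫⁻ a, F n a ∂(μs n : Measure A) ≤ vs n) :
    ∃ μ : ProbabilityMeasure A, IsBarycenter μ x ∧ ∫⁻ a, (⨆ n, F n a) ∂(μ : Measure A) ≤ v := by
  let := TopologicalSpace.metrizableSpaceMetric A
  let := TopologicalSpace.metrizableSpaceMetric (ProbabilityMeasure A)
  obtain ⟨μ, -, k, hk, hμ⟩ := (hcomp _ hx.isCompact_insert_range).isSeqCompact
    (x := μs) fun n => ⟨xs n, Set.mem_insert_of_mem _ (Set.mem_range_self n), hb n⟩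
  refine ⟨μ, IsBarycenter.of_tendsto hbdd (fun j => hb (k j)) hμ (hx.comp hk.tendsto_atTop), ?_⟩
  rw [lintegral_iSup (fun n => (hF n).measurable) hmono]
  refine iSup_le fun m => ?_
  calc ∫⁻ a, F m a ∂(μ : Measure A)
      ≤ atTop.liminf fun j => ∫⁻ a, F m a ∂(μs (k j) : Measure A) :=
        lintegral_le_liminf_of_lowerSemicontinuous hμ (hF m)
    _ ≤ atTop.liminf fun j => vs (k j) := by
        refine liminf_le_liminf ?_
        filter_upwards [hk.tendsto_atTop.eventually_ge_atTop m] with j hj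
        exact (lintegral_mono (hmono hj)).trans (hle (k j))
    _ = v := (hv.comp hk.tendsto_atTop).liminf_eq

theorem IsMuCompact.exists_lintegral_eq_barycentricInf (hcomp : IsMuCompact A)
    (hbdd : Bornology.IsVonNBounded ℝ A) {F : A → ℝ≥0∞} (hF : LowerSemicontinuous F) (x : A) :
    ∃ μ : ProbabilityMeasure A, IsBarycenter μ x ∧
      ∫⁻ a, F a ∂(μ : Measure A) = barycentricInf F x := by
  obtain ⟨vs, -, hvs, hmem⟩ := exists_seq_tendsto_sInf
    (S := {v | ∃ μ : ProbabilityMeasure A, IsBarycenter μ x ∧ ∫⁻ a, F a ∂(μ : Measure A) = v})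
    ⟨_, diracProba x, isBarycenter_diracProba x, rfl⟩ (OrderBot.bddBelow _)
  choose μs hb hint using hmem
  obtain ⟨μ, hμ, hle⟩ := hcomp.exists_lintegral_le hbdd (F := fun _ => F) monotone_const
    (fun _ => hF) tendsto_const_nhds hb hvs fun n => (hint n).le
  simp only [ciSup_const] at hle
  exact ⟨μ, hμ, hle.antisymm (barycentricInf_le hμ)⟩

theorem IsMuCompact.lowerSemicontinuous_barycentricInf (hcomp : IsMuCompact A)
    (hbdd : Bornology.IsVonNBounded ℝ A) {F : A → ℝ≥0∞} (hF : LowerSemicontinuous F) :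
    LowerSemicontinuous (barycentricInf F) := by
  let := TopologicalSpace.metrizableSpaceMetric A
  refine lowerSemicontinuous_iff_isClosed_preimage.2 fun v => IsSeqClosed.isClosed ?_
  intro xs x hxs hx
  choose μs hb hint using fun n => hcomp.exists_lintegral_eq_barycentricInf hbdd hF (xs n)
  obtain ⟨μ, hμ, hle⟩ := hcomp.exists_lintegral_le hbdd (F := fun _ => F) monotone_const
    (fun _ => hF) hx hb (tendsto_const_nhds (x := v)) fun n => (hint n).trans_le (hxs n)
  simp only [ciSup_const] at hle
  exact (barycentricInf_le hμ).trans hle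

theorem IsMuCompact.isConvexFun_barycentricInf (hcomp : IsMuCompact A)
    (hbdd : Bornology.IsVonNBounded ℝ A) (hA : Convex ℝ A) (c : ℝ) {F : A → ℝ≥0∞}
    (hF : LowerSemicontinuous F) :
    IsConvexFun fun x : A => (c : EReal) + (barycentricInf F x : EReal) := by
  rintro ⟨x, r⟩ ⟨hx, hr⟩ ⟨y, s⟩ ⟨hy, hs⟩ a b ha hb hab
  refine ⟨hA hx hy ha hb hab, ?_⟩
  obtain ⟨v, hv, hcv, hxv⟩ := (coe_add_coe_ennreal_le_coe_iff _ _ _).1 hr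
  obtain ⟨w, hw, hcw, hyw⟩ := (coe_add_coe_ennreal_le_coe_iff _ _ _).1 hs
  obtain ⟨μ, hμ, hμx⟩ := hcomp.exists_lintegral_eq_barycentricInf hbdd hF ⟨x, hx⟩
  obtain ⟨ν, hν, hνy⟩ := hcomp.exists_lintegral_eq_barycentricInf hbdd hF ⟨y, hy⟩
  refine (coe_add_coe_ennreal_le_coe_iff _ _ _).2 ⟨a * v + b * w, by positivity, ?_, ?_⟩
  · have h1 := mul_le_mul_of_nonneg_left hcv ha
    have h2 := mul_le_mul_of_nonneg_left hcw hb
    have h3 : c = a * c + b * c := by rw [← add_mul, hab, one_mul]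
    simp only [Prod.snd_add, Prod.smul_snd, smul_eq_mul]
    linarith
  · refine (barycentricInf_le (hμ.mix hν ha hb hab rfl)).trans ?_
    rw [lintegral_mix, hμx, hνy, ENNReal.ofReal_add (by positivity) (by positivity),
      ENNReal.ofReal_mul ha, ENNReal.ofReal_mul hb]
    gcongr

variable [IsTopologicalAddGroup E] [ContinuousSMul ℝ E] [LocallyConvexSpace ℝ E]

/-- On a `μ`-compact set the convex closure of a lower semicontinuous function that is bounded below
is the infimum of its means over the measures with the given barycenter. -/
theorem IsMuCompact.convexClosure_eq (hcomp : IsMuCompact A)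
    (hbdd : Bornology.IsVonNBounded ℝ A) (hA : Convex ℝ A) (c : ℝ) {F : A → ℝ≥0∞}
    (hF : LowerSemicontinuous F) (x : A) :
    convexClosure (fun a => (c : EReal) + F a) x = (c : EReal) + (barycentricInf F x : EReal) := by
  refine le_antisymm ?_ ?_
  · obtain ⟨μ, hμ, hμx⟩ := hcomp.exists_lintegral_eq_barycentricInf hbdd hF x
    exact hμx ▸ convexClosure_le_lintegral hA c F hμ
  · refine (isGreatest_convexClosure hA _).2
      ⟨hcomp.isConvexFun_barycentricInf hbdd hA c hF, ?_, fun a => ?_⟩ x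
    · exact (continuous_coe_add_coe_ennreal c).comp_lowerSemicontinuous
        (hcomp.lowerSemicontinuous_barycentricInf hbdd hF) (monotone_coe_add_coe_ennreal c)
    · exact monotone_coe_add_coe_ennreal c (barycentricInf_le_self hF.measurable a)

end Duality

/-! ### Monotone limits on `μ`-compact sets -/

section MonotoneLimits

/-- An extended real valued function bounded below by `c` has the form `c + F` with `F ≥ 0`. -/
theorem coe_add_toENNReal_sub {c : ℝ} {t : EReal} (h : (c : EReal) ≤ t) :
    (c : EReal) + ((t - c).toENNReal : EReal) = t := by
  have h0 : 0 ≤ t - c := EReal.sub_nonneg (Or.inr (EReal.coe_ne_top c))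
    (Or.inr (EReal.coe_ne_bot c)) |>.2 h
  rw [EReal.coe_toENNReal h0, add_comm, EReal.sub_add_cancel]

theorem monotone_toENNReal_sub (c : ℝ) : Monotone fun t : EReal => (t - c).toENNReal :=
  fun _ _ h => EReal.toENNReal_le_toENNReal (EReal.sub_le_sub h le_rfl)

theorem continuous_toENNReal_sub (c : ℝ) : Continuous fun t : EReal => (t - c).toENNReal := by
  refine EReal.continuous_toENNReal.comp (continuous_iff_continuousAt.2 fun t => ?_)
  simp only [sub_eq_add_neg, ← EReal.coe_neg]
  exact ContinuousAt.comp (f := fun t : EReal => (t, ((-c : ℝ) : EReal)))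
    (EReal.continuousAt_add (Or.inr (EReal.coe_ne_bot _)) (Or.inr (EReal.coe_ne_top _)))
    (continuous_id.prodMk continuous_const).continuousAt

variable {E : Type*} [AddCommGroup E] [Module ℝ E] [TopologicalSpace E] {A : Set E}
  [MeasurableSpace A] [BorelSpace A] [TopologicalSpace.MetrizableSpace A]
  [TopologicalSpace.SeparableSpace A]

theorem IsMuCompact.tendsto_barycentricInf (hcomp : IsMuCompact A)
    (hbdd : Bornology.IsVonNBounded ℝ A) {F : ℕ → A → ℝ≥0∞} (hmono : Monotone F)
    (hF : ∀ n, LowerSemicontinuous (F n)) (x : A) :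
    Tendsto (fun n => barycentricInf (F n) x) atTop
      (𝓝 (barycentricInf (fun a => ⨆ n, F n a) x)) := by
  have hm : Monotone fun n => barycentricInf (F n) x := fun m n h =>
    barycentricInf_mono (hmono h) x
  have ht := tendsto_atTop_iSup hm
  choose μs hb hint using fun n => hcomp.exists_lintegral_eq_barycentricInf hbdd (hF n) x
  obtain ⟨μ, hμ, hle⟩ := hcomp.exists_lintegral_le hbdd hmono hF tendsto_const_nhds hb ht
    fun n => (hint n).le
  have heq : barycentricInf (fun a => ⨆ n, F n a) x = ⨆ n, barycentricInf (F n) x :=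
    le_antisymm ((barycentricInf_le hμ).trans hle)
      (iSup_le fun n => barycentricInf_mono (fun a => le_iSup (fun n => F n a) n) x)
  rwa [heq]

variable [IsTopologicalAddGroup E] [ContinuousSMul ℝ E] [LocallyConvexSpace ℝ E]

theorem IsMuCompact.tendsto_convexClosure_of_monotone (hcomp : IsMuCompact A)
    (hbdd : Bornology.IsVonNBounded ℝ A) (hA : Convex ℝ A) {f : ℕ → A → EReal} {f₀ : A → EReal}
    (hf : ∀ n, LowerSemicontinuous (f n)) (hbelow : ∀ n, ∃ c : ℝ, ∀ x, (c : EReal) ≤ f n x)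
    (hmono : ∀ n x, f n x ≤ f (n + 1) x) (hlim : ∀ x, Tendsto (fun n => f n x) atTop (𝓝 (f₀ x)))
    (x : A) : Tendsto (fun n => convexClosure (f n) x) atTop (𝓝 (convexClosure f₀ x)) := by
  obtain ⟨c, hc⟩ := hbelow 0
  have hm : ∀ a, Monotone fun n => f n a := fun a => monotone_nat_of_le_succ fun n => hmono n a
  have hcn : ∀ n a, (c : EReal) ≤ f n a := fun n a => (hc a).trans (hm a (Nat.zero_le n))
  set F : ℕ → A → ℝ≥0∞ := fun n a => (f n a - c).toENNReal with hFdef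
  have hF : ∀ n, LowerSemicontinuous (F n) := fun n =>
    (continuous_toENNReal_sub c).comp_lowerSemicontinuous (hf n) (monotone_toENNReal_sub c)
  have hFm : Monotone F := fun m n h a => monotone_toENNReal_sub c (hm a h)
  have hfF : ∀ n, f n = fun a => (c : EReal) + F n a := fun n =>
    funext fun a => (coe_add_toENNReal_sub (hcn n a)).symm
  have hf₀ : f₀ = fun a => (c : EReal) + ((⨆ n, F n a : ℝ≥0∞) : EReal) := by
    funext a
    refine tendsto_nhds_unique (hlim a) ?_
    refine (((continuous_coe_add_coe_ennreal c).tendsto _).comp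
      (tendsto_atTop_iSup fun m n h => hFm h a)).congr fun n => ?_
    exact coe_add_toENNReal_sub (hcn n a)
  rw [hf₀, hcomp.convexClosure_eq hbdd hA c (lowerSemicontinuous_iSup hF) x]
  refine (((continuous_coe_add_coe_ennreal c).tendsto _).comp
    (hcomp.tendsto_barycentricInf hbdd hFm hF x)).congr fun n => ?_
  rw [hfF n, hcomp.convexClosure_eq hbdd hA c (hF n) x]
  rfl

theorem IsMuCompact.tendsto_convexClosure_of_antitone (hcomp : IsMuCompact A)
    (hbdd : Bornology.IsVonNBounded ℝ A) (hA : Convex ℝ A) {f : ℕ → A → ℝ} {f₀ : A → ℝ}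
    (hf : ∀ n, LowerSemicontinuous (f n)) (habove : ∃ C : ℝ, ∀ x, f 0 x ≤ C)
    (hf₀ : LowerSemicontinuous f₀) (hbelow : ∃ c : ℝ, ∀ x, c ≤ f₀ x)
    (hanti : ∀ n x, f (n + 1) x ≤ f n x) (hlim : ∀ x, Tendsto (fun n => f n x) atTop (𝓝 (f₀ x)))
    (x : A) : Tendsto (fun n => convexClosure (fun a : A => (f n a : EReal)) x) atTop
      (𝓝 (convexClosure (fun a : A => (f₀ a : EReal)) x)) := by
  obtain ⟨C, hC⟩ := habove
  obtain ⟨c, hc⟩ := hbelow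
  have hm : ∀ a, Antitone fun n => f n a := fun a => antitone_nat_of_succ_le fun n => hanti n a
  have hle : ∀ n a, f₀ a ≤ f n a := fun n a => (hm a).le_of_tendsto (hlim a) n
  have hrepr : ∀ g : A → ℝ, (∀ a, c ≤ g a) →
      (fun a => (g a : EReal)) = fun a => (c : EReal) + (ENNReal.ofReal (g a - c) : EReal) :=
    fun g hg => funext fun a => by
      rw [EReal.coe_ennreal_ofReal, max_eq_left (sub_nonneg.2 (hg a)), ← EReal.coe_add,
        add_sub_cancel]
  have hcont : Continuous fun t : ℝ => ENNReal.ofReal (t - c) :=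
    ENNReal.continuous_ofReal.comp (continuous_id.sub continuous_const)
  have hmeas : ∀ n, Measurable fun a => ENNReal.ofReal (f n a - c) := fun n =>
    hcont.measurable.comp (hf n).measurable
  have hF₀ : LowerSemicontinuous fun a => ENNReal.ofReal (f₀ a - c) :=
    hcont.comp_lowerSemicontinuous hf₀ fun s t h =>
      ENNReal.ofReal_le_ofReal (sub_le_sub_right h c)
  obtain ⟨μ, hμ, hμx⟩ := hcomp.exists_lintegral_eq_barycentricInf hbdd hF₀ x
  -- The optimal measure for `f₀` gives upper bounds for all the convex closures.
  have hint : Tendsto (fun n => ∫⁻ a, ENNReal.ofReal (f n a - c) ∂(μ : Measure A)) atTop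
      (𝓝 (∫⁻ a, ENNReal.ofReal (f₀ a - c) ∂(μ : Measure A))) := by
    refine lintegral_tendsto_of_tendsto_of_antitone (fun n => (hmeas n).aemeasurable)
      (Eventually.of_forall fun a m n h => ENNReal.ofReal_le_ofReal (sub_le_sub_right (hm a h) c))
      ?_ (Eventually.of_forall fun a => (hcont.tendsto _).comp (hlim a))
    refine ne_top_of_le_ne_top (ENNReal.ofReal_ne_top (r := C - c)) ?_
    calc _ ≤ ∫⁻ _, ENNReal.ofReal (C - c) ∂(μ : Measure A) := lintegral_mono fun a =>
          ENNReal.ofReal_le_ofReal (sub_le_sub_right (hC a) c)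
      _ = ENNReal.ofReal (C - c) := by simp
  have hup := ((continuous_coe_add_coe_ennreal c).tendsto _).comp hint
  have hopt : convexClosure (fun a => (f₀ a : EReal)) x =
      (c : EReal) + (∫⁻ a, ENNReal.ofReal (f₀ a - c) ∂(μ : Measure A) : ℝ≥0∞) := by
    rw [hrepr f₀ hc, hcomp.convexClosure_eq hbdd hA c hF₀ x, hμx]
  refine tendsto_of_tendsto_of_tendsto_of_le_of_le tendsto_const_nhds (hopt ▸ hup)
    (fun n => convexClosure_mono hA (fun a => EReal.coe_le_coe_iff.2 (hle n a)) x) fun n => ?_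
  simp only
  rw [hrepr (f n) fun a => (hc a).trans (hle n a)]
  exact convexClosure_le_lintegral hA c _ hμ

end MonotoneLimits

/-! ### From continuity of the convex closure to `μ`-compactness -/

section BallBump

variable {X : Type*} [PseudoMetricSpace X] (D : ℕ → X) {δ : ℝ} (hδ : 0 < δ)

/-- Thickened indicators of the unions of the first `n` balls around the terms of a sequence. For a
dense sequence they increase to `1`, and each point is reached after finitely many steps. -/
noncomputable def ballBump (n : ℕ) : X →ᵇ ℝ :=
  BoundedContinuousFunction.comp ((↑) : NNReal → ℝ) (LipschitzWith.subtype_val _)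
    (thickenedIndicator hδ (⋃ i ∈ Finset.range n, Metric.closedBall (D i) δ))

theorem ballBump_apply (n : ℕ) (a : X) : ballBump D hδ n a =
    thickenedIndicator hδ (⋃ i ∈ Finset.range n, Metric.closedBall (D i) δ) a := rfl

theorem ballBump_le_succ (n : ℕ) (a : X) : ballBump D hδ n a ≤ ballBump D hδ (n + 1) a := by
  rw [ballBump_apply, ballBump_apply, NNReal.coe_le_coe]
  refine thickenedIndicator_subset hδ (Set.biUnion_subset_biUnion_left fun i hi => ?_) a
  exact Finset.range_subset_range.2 n.le_succ hi

theorem tendsto_ballBump (hD : DenseRange D) (a : X) :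
    Tendsto (fun n => ballBump D hδ n a) atTop (𝓝 1) := by
  obtain ⟨i, hi⟩ := Metric.denseRange_iff.1 hD a δ hδ
  refine tendsto_const_nhds.congr' ?_
  filter_upwards [eventually_gt_atTop i] with n hn
  rw [ballBump_apply, thickenedIndicator_one hδ, NNReal.coe_one]
  exact Set.mem_biUnion (Finset.mem_coe.2 (Finset.mem_range.2 hn)) (Metric.mem_closedBall.2 hi.le)

theorem lintegral_ballBump_le [MeasurableSpace X] [OpensMeasurableSpace X] (n : ℕ)
    (μ : Measure X) : ∫⁻ a, ENNReal.ofReal (ballBump D hδ n a) ∂μ ≤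
      μ (⋃ i ∈ Finset.range n, Metric.closedBall (D i) (2 * δ)) := by
  have hm : MeasurableSet (⋃ i ∈ Finset.range n, Metric.closedBall (D i) (2 * δ)) :=
    Finset.measurableSet_biUnion _ fun i _ => Metric.isClosed_closedBall.measurableSet
  rw [← lintegral_indicator_one hm]
  refine lintegral_mono fun a => ?_
  by_cases ha : a ∈ ⋃ i ∈ Finset.range n, Metric.closedBall (D i) (2 * δ)
  · rw [Set.indicator_of_mem ha, ballBump_apply, Pi.one_apply, ENNReal.ofReal_coe_nnreal]
    exact ENNReal.coe_le_one_iff.2 (thickenedIndicator_le_one hδ _ a)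
  · rw [Set.indicator_of_notMem ha, ballBump_apply, thickenedIndicator_zero hδ]
    · simp
    · intro hth
      obtain ⟨z, hz, haz⟩ := Metric.mem_thickening_iff.1 hth
      obtain ⟨i, hi, hzi⟩ := Set.mem_iUnion₂.1 hz
      refine ha (Set.mem_iUnion₂.2 ⟨i, hi, Metric.mem_closedBall.2 ?_⟩)
      have h1 := dist_triangle a z (D i)
      have h2 := Metric.mem_closedBall.1 hzi
      linarith

end BallBump

section Converse

variable {E : Type*} [AddCommGroup E] [Module ℝ E] [TopologicalSpace E]
  [IsTopologicalAddGroup E] [ContinuousSMul ℝ E] [LocallyConvexSpace ℝ E] {A : Set E}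
  [MeasurableSpace A] [BorelSpace A]

/-- If the convex closure is continuous along increasing sequences in `C(A)`, then the measures with
barycenters in a compact set form a tight family, by a Dini argument for the functions `ballBump`
and Jensen's inequality. -/
theorem isMuCompact_of_tendsto_convexClosure [TopologicalSpace.IsCompletelyMetrizableSpace A]
    [TopologicalSpace.SeparableSpace A] (hbdd : Bornology.IsVonNBounded ℝ A) (hA : Convex ℝ A)
    (h : ∀ (f : ℕ → (A →ᵇ ℝ)) (f₀ : A →ᵇ ℝ), (∀ n x, f n x ≤ f (n + 1) x) →
      (∀ x, Tendsto (fun n => f n x) atTop (𝓝 (f₀ x))) →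
      ∀ x, Tendsto (fun n => convexClosure (fun a : A => (f n a : EReal)) x) atTop
        (𝓝 (convexClosure (fun a : A => (f₀ a : EReal)) x))) : IsMuCompact A := by
  let := TopologicalSpace.upgradeIsCompletelyMetrizable A
  let := TopologicalSpace.metrizableSpaceMetric (ProbabilityMeasure A)
  intro K hK
  rcases isEmpty_or_nonempty A with hempty | hne
  · convert isCompact_empty
    ext μ
    simp
  obtain ⟨D, hD⟩ := TopologicalSpace.exists_dense_seq A
  have hclosed : IsClosed {μ : ProbabilityMeasure A | ∃ x ∈ K, IsBarycenter μ x} := by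
    refine IsSeqClosed.isClosed fun μs μ hμs hμ => ?_
    choose xs hxK hb using hμs
    obtain ⟨x, hx, k, hk, hxs⟩ := hK.isSeqCompact hxK
    exact ⟨x, hx, IsBarycenter.of_tendsto hbdd (fun j => hb (k j)) (hμ.comp hk.tendsto_atTop) hxs⟩
  rw [← hclosed.closure_eq]
  refine isCompact_closure_of_isTightMeasureSet
    (isTightMeasureSet_of_forall_exists_closedBall (D := D) fun δ hδ ε hε => ?_)
  have hδ2 : 0 < δ / 2 := half_pos hδ
  set f : ℕ → (A →ᵇ ℝ) := ballBump D hδ2 with hf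
  set g : ℕ → A → EReal := fun n => convexClosure fun a => (f n a : EReal) with hg
  have hgmono : Monotone g := monotone_nat_of_le_succ fun n => convexClosure_mono hA fun a =>
    EReal.coe_le_coe_iff.2 (ballBump_le_succ D hδ2 n a)
  obtain ⟨η, hη, hηε⟩ : ∃ η : ℝ, 0 < η ∧ ENNReal.ofReal η ≤ ε := by
    obtain ⟨η, -, h1, h2⟩ := ENNReal.lt_iff_exists_real_btwn.1 hε
    exact ⟨η, ENNReal.ofReal_pos.1 h1, h2.le⟩
  -- Dini's argument: the convex closures exceed `1 - η` on all of `K` from some index on.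
  obtain ⟨n, hn⟩ : ∃ n, K ⊆ g n ⁻¹' Set.Ioi ((1 - η : ℝ) : EReal) := by
    refine hK.elim_directed_cover _
      (fun n => ((isGreatest_convexClosure hA _).1.2.1).isOpen_preimage _) (fun x _ => ?_)
      (Monotone.directed_le fun m n hmn x hx => lt_of_lt_of_le hx (hgmono hmn x))
    have ht := h f (BoundedContinuousFunction.const A 1) (ballBump_le_succ D hδ2)
      (tendsto_ballBump D hδ2 hD) x
    have h1 : ((1 : ℝ) : EReal) ≤ convexClosure
        (fun a : A => ((BoundedContinuousFunction.const A (1 : ℝ) a : ℝ) : EReal)) x :=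
      le_convexClosure_of_forall_le hA (fun a => le_rfl) x
    have h2 : ((1 - η : ℝ) : EReal) < ((1 : ℝ) : EReal) := EReal.coe_lt_coe_iff.2 (by linarith)
    obtain ⟨n, hn⟩ := (ht.eventually (lt_mem_nhds (h2.trans_le h1))).exists
    exact Set.mem_iUnion.2 ⟨n, hn⟩
  refine ⟨n, ?_⟩
  rintro _ ⟨μ, ⟨x, hx, hb⟩, rfl⟩
  have hfn : (fun a => (f n a : EReal)) =
      fun a => ((0 : ℝ) : EReal) + (ENNReal.ofReal (f n a) : EReal) := by
    funext a
    have h0 : 0 ≤ f n a := NNReal.coe_nonneg _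
    rw [EReal.coe_ennreal_ofReal, max_eq_left h0, EReal.coe_zero, zero_add]
  have hball := lintegral_ballBump_le D hδ2 n (μ : Measure A)
  rw [mul_div_cancel₀ _ (two_ne_zero' ℝ)] at hball
  set B := ⋃ i ∈ Finset.range n, Metric.closedBall (D i) δ with hB
  have hBm : MeasurableSet B :=
    Finset.measurableSet_biUnion _ fun i _ => Metric.isClosed_closedBall.measurableSet
  have hlow : ((1 - η : ℝ) : EReal) < ((μ : Measure A) B : EReal) := by
    refine (hn hx).trans_le ?_
    have hJ := convexClosure_le_lintegral hA 0 (fun a => ENNReal.ofReal (f n a)) hb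
    rw [← hfn, EReal.coe_zero, zero_add] at hJ
    exact hJ.trans (EReal.coe_ennreal_le_coe_ennreal_iff.2 hball)
  have hreal : 1 - η < (μ : Measure A).real B := by
    rw [← ENNReal.ofReal_toReal (measure_ne_top (μ : Measure A) B), EReal.coe_ennreal_ofReal,
      max_eq_left ENNReal.toReal_nonneg] at hlow
    exact EReal.coe_lt_coe_iff.1 hlow
  refine le_trans ?_ hηε
  rw [← ENNReal.ofReal_toReal (measure_ne_top (μ : Measure A) Bᶜ)]
  refine ENNReal.ofReal_le_ofReal ?_
  have := probReal_compl_eq_one_sub (μ := (μ : Measure A)) hBm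
  rw [Measure.real] at this
  linarith

end Converse

end MuCompact

theorem mainTheorem1
    {E : Type*} [AddCommGroup E] [Module ℝ E] [TopologicalSpace E]
    [IsTopologicalAddGroup E] [ContinuousSMul ℝ E] [LocallyConvexSpace ℝ E]
    (A : Set E) [MeasurableSpace A] [BorelSpace A]
    (hA_bounded : Bornology.IsVonNBounded ℝ A)
    (hA_convex : Convex ℝ A)
    (hA_separable : TopologicalSpace.SeparableSpace A)
    (hA_complete : MuCompact.IsCompleteMetrizable A) :
    List.TFAE [
      MuCompact.IsMuCompact A,
      ∀ (f : ℕ → (A →ᵇ ℝ)) (f₀ : A →ᵇ ℝ),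
        (∀ n x, f n x ≤ f (n + 1) x) →
        (∀ x, Tendsto (fun n => f n x) atTop (𝓝 (f₀ x))) →
        ∀ x, Tendsto (fun n => MuCompact.convexClosure (fun a : A => (f n a : EReal)) x) atTop
          (𝓝 (MuCompact.convexClosure (fun a : A => (f₀ a : EReal)) x)),
      ∀ (f : ℕ → A → EReal) (f₀ : A → EReal),
        (∀ n, LowerSemicontinuous (f n)) →
        (∀ n, ∃ c : ℝ, ∀ x, (c : EReal) ≤ f n x) →
        (∀ n x, f n x ≤ f (n + 1) x) →
        (∀ x, Tendsto (fun n => f n x) atTop (𝓝 (f₀ x))) →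
        ∀ x, Tendsto (fun n => MuCompact.convexClosure (f n) x) atTop
          (𝓝 (MuCompact.convexClosure f₀ x))] ∧
    (MuCompact.IsMuCompact A →
      ∀ (f : ℕ → A → ℝ) (f₀ : A → ℝ),
        (∀ n, LowerSemicontinuous (f n)) →
        (∀ n, ∃ C : ℝ, ∀ x, |f n x| ≤ C) →
        LowerSemicontinuous f₀ →
        (∃ C : ℝ, ∀ x, |f₀ x| ≤ C) →
        (∀ n x, f (n + 1) x ≤ f n x) →
        (∀ x, Tendsto (fun n => f n x) atTop (𝓝 (f₀ x))) →
        ∀ x, Tendsto (fun n => MuCompact.convexClosure (fun a : A => (f n a : EReal)) x) atTop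
          (𝓝 (MuCompact.convexClosure (fun a : A => (f₀ a : EReal)) x))) := by
  have := hA_complete.isCompletelyMetrizableSpace
  refine ⟨?_, fun hcomp f f₀ hf hbdd hf₀ hbdd₀ hanti hlim => ?_⟩
  · tfae_have 1 → 3 := fun hcomp f f₀ hf hbelow hmono hlim =>
      hcomp.tendsto_convexClosure_of_monotone hA_bounded hA_convex hf hbelow hmono hlim
    tfae_have 3 → 2 := fun h f f₀ hmono hlim => by
      refine h _ _ (fun n => ?_) (fun n => ⟨-‖f n‖, fun a => EReal.coe_le_coe_iff.2 ?_⟩)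
        (fun n a => EReal.coe_le_coe_iff.2 (hmono n a))
        fun a => (continuous_coe_real_ereal.tendsto _).comp (hlim a)
      · exact (continuous_coe_real_ereal.comp (f n).continuous).lowerSemicontinuous
      · exact neg_le_of_abs_le ((f n).norm_coe_le_norm a)
    tfae_have 2 → 1 := MuCompact.isMuCompact_of_tendsto_convexClosure hA_bounded hA_convex
    tfae_finish
  · obtain ⟨C, hC⟩ := hbdd 0
    obtain ⟨c, hc⟩ := hbdd₀
    exact hcomp.tendsto_convexClosure_of_antitone hA_bounded hA_convex hf
      ⟨C, fun a => le_of_abs_le (hC a)⟩ hf₀ ⟨-c, fun a => neg_le_of_abs_le (hc a)⟩ hanti hlim
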